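/- **Conventions.** $\mathbb K$ is a commutative topological ring with unit in which $2$ is invertible, whose unit group $\mathbb K^\times$ is open and dense and has continuous inversion. Topological $\mathbb K$-modules are Hausdorff. For $U$ open in a topological $\mathbb K$-module $E$, a continuous map $f:U\to W$ to a topological $\mathbb K$-module is $C^1$ if there is a continuous map $f^{[1]}$ on $U^{[1]}=\{(x,v,t)\in U\times E\times\mathbb K : x+tv\in U\}$ with $f(x+tv)-f(x)=t\,f^{[1]}(x,v,t)$; then $df(x)v:=f^{[1]}(x,v,0)$. It is $C^{k+1}$ if it is $C^1$ and $f^{[1]}$ is $C^k$, and smooth if it is $C^k$ for all $k$. Smooth manifolds, smooth maps and tangent maps are defined by charts as usual. The bracket of vector fields is $[X,Y](x)=dY(x)X(x)-dX(x)Y(x)$ in charts. A *symmetric space over $\mathbb K$* is a smooth manifold $M$ with a smooth map $m:M\times M\to M$ such that, with $\sigma_x:=m(x,\cdot)$: $m(x,x)=x$; $\sigma_x^2=\mathrm{id}_M$; $\sigma_x(m(y,z))=m(\sigma_x y,\sigma_x z)$; $T_x(\sigma_x)=-\mathrm{id}_{T_xM}$. The group $G(M)$ is generated by all $\sigma_x\sigma_y$.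 For a base point $o\in M$, the *quadratic representation* is $M\to G(M)$, $x\mapsto\sigma_x\sigma_o$, and the *Lie triple system* of $(M,o)$ is $T_oM$ with $[u,v,w]=-R_o(u,v)w:=[[\tilde u,\tilde v],\tilde w](o)$, where $\tilde u$ is the vector field $\tilde u(p)=\tfrac12\,Tm(u,Tm(0_o,0_p))$. Let $V$ be a unital Jordan algebra over $\mathbb K$ (a commutative $\mathbb K$-algebra with $x\bullet(x^2\bullet y)=x^2\bullet(x\bullet y)$) which is a Hausdorff topological $\mathbb K$-module with continuous product. Put $L(x)y=x\bullet y$, $Q(x)=2L(x)^2-L(x^2)$, $V^\times=\{x\in V: Q(x)\text{ is invertible}\}$, and $x^{-1}=Q(x)^{-1}x$ for $x\in V^\times$. Call $V$ a *continuous inverse Jordan algebra* if $V^\times$ is open in $V$ and $x\mapsto x^{-1}$, $V^\times\to V$, is continuous. **Theorem 3.4.** Let $V$ be a continuous inverse Jordan algebra over $\mathbb K$. Then the open subset $M:=V^\times$ of $V$ is a symmetric space over $\mathbb K$ with the product $$m:M\times M\to M,\qquad m(x,y)=Q(x)y^{-1}=Q(x)Q(y)^{-1}y$$ (in particular $Q(x)y^{-1}\in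 V^\times$ for $x,y\in V^\times$). The map $Q:V\to\mathrm{End}(V)$ is a homogeneous quadratic polynomial map, $(x,v)\mapsto Q(x)v$ is continuous, and $Q$ extends the quadratic representation of $M$ with base point $\mathbf 1$: $\sigma_x\sigma_{\mathbf 1}(y)=Q(x)y$ for all $x,y\in M$. The Lie triple system on $T_{\mathbf 1}M\cong V$ is given by $$-R(x,y)z=[[L(x),L(y)],L(z)]\mathbf 1=[L(x),L(y)]z=x\bullet(y\bullet z)-y\bullet(x\bullet z)\qquad(x,y,z\in V).$$ -/

import Mathlib

universe u v w

/-! ### Base ring -/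

/-- The standing conditions on a commutative topological ring `K`: the unit group is open and dense,
and inversion is continuous on it. -/
class HasDenseOpenUnits (K : Type v) [CommRing K] [TopologicalSpace K] : Prop where
  isOpen_units : IsOpen {a : K | IsUnit a}
  dense_units : Dense {a : K | IsUnit a}
  continuousOn_inverse : ContinuousOn (Ring.inverse : K → K) {a : K | IsUnit a}

/-! ### Differential calculus over topological rings -/

section Calculus

/-- The set `U^{[1]} = {(x, v, t) | x ∈ U, x + t v ∈ U}`. -/
def slopeDomain (K : Type v) [CommRing K] {V : Type u} [AddCommGroup V] [Module K V]
    (U : Set V) : Set (V × V × K) :=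
  {p | p.1 ∈ U ∧ p.1 + p.2.2 • p.2.1 ∈ U}

/-- `g` is a map `f^{[1]}`: it is continuous on `U^{[1]}`, and
`f (x + t v) - f x = t • g (x, v, t)` there. -/
def IsSlope (K : Type v) [CommRing K] [TopologicalSpace K]
    {V : Type u} [AddCommGroup V] [Module K V] [TopologicalSpace V]
    {W : Type w} [AddCommGroup W] [Module K W] [TopologicalSpace W]
    (U : Set V) (f : V → W) (g : V × V × K → W) : Prop :=
  ContinuousOn g (slopeDomain K U) ∧
    ∀ x v : V, ∀ t : K, (x, v, t) ∈ slopeDomain K U → f (x + t • v) - f x = t • g (x, v, t)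

/-- The classes `C^k`, by recursion on `k`: `C^0` is continuity, and `f` is `C^{k+1}` iff it has an
`f^{[1]}` which is `C^k` on `U^{[1]}`.  The domain changes from `V` to `V × V × K` in each step, so
the universe of `V` has to be at least that of `K` here. -/
def IsCkAux (K : Type v) [CommRing K] [TopologicalSpace K]
    {W : Type w} [AddCommGroup W] [Module K W] [TopologicalSpace W] :
    ℕ → ∀ {V : Type (max u v)} [AddCommGroup V] [Module K V] [TopologicalSpace V],
      Set V → (V → W) → Prop
  | 0, _, _, _, _, U, f => ContinuousOn f U
  | k + 1, V, _, _, _, U, f =>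
      ∃ g : V × V × K → W, IsSlope K U f g ∧ IsCkAux K k (slopeDomain K U) g

/-- `f : U → W` is of class `C^k`.  (`ULift` only adjusts the universe of the domain.) -/
def IsCk (K : Type v) [CommRing K] [TopologicalSpace K]
    {V : Type u} [AddCommGroup V] [Module K V] [TopologicalSpace V]
    {W : Type w} [AddCommGroup W] [Module K W] [TopologicalSpace W]
    (k : ℕ) (U : Set V) (f : V → W) : Prop :=
  IsCkAux.{u, v, w} K k (ULift.down ⁻¹' U : Set (ULift.{v} V)) (fun x => f x.down)

/-- `f : U → W` is smooth, i.e. of class `C^k` for all `k`. -/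
def IsSmoothOn (K : Type v) [CommRing K] [TopologicalSpace K]
    {V : Type u} [AddCommGroup V] [Module K V] [TopologicalSpace V]
    {W : Type w} [AddCommGroup W] [Module K W] [TopologicalSpace W]
    (U : Set V) (f : V → W) : Prop :=
  ∀ k : ℕ, IsCk K k U f

open Classical in
/-- The differential `df(x)v = f^{[1]}(x, v, 0)` of a `C^1`-map `f : U → W`
(and `0` if `f` is not `C^1`).  For `U` open, `W` Hausdorff and `K` with dense unit group,
`f^{[1]}` is unique on `U^{[1]}`, so the choice does not matter. -/
noncomputable def differential (K : Type v) [CommRing K] [TopologicalSpace K]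
    {V : Type u} [AddCommGroup V] [Module K V] [TopologicalSpace V]
    {W : Type w} [AddCommGroup W] [Module K W] [TopologicalSpace W]
    (U : Set V) (f : V → W) (x v : V) : W :=
  if h : ∃ g : V × V × K → W, IsSlope K U f g then h.choose (x, v, 0) else 0

end Calculus

/-! ### Manifolds, tangent maps, vector fields

The tangent space `T_p M` of a manifold modelled on `E` is identified with `E` through the preferred
chart `chartAt E p`. -/

section Manifolds

/-- `M`, with the given atlas of charts into the topological `K`-module `E`, is a smooth manifold:
all changes of charts are smooth. -/
class IsSmoothManifold (K : Type v) [CommRing K] [TopologicalSpace K]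
    (E : Type u) [AddCommGroup E] [Module K E] [TopologicalSpace E]
    (M : Type w) [TopologicalSpace M] [ChartedSpace E M] : Prop where
  compatible : ∀ e ∈ atlas E M, ∀ e' ∈ atlas E M,
    IsSmoothOn K (e.symm.trans e').source (e.symm.trans e')

/-- A binary map `m : M × M → M` is smooth: it is continuous, and smooth in all charts, where
`M × M` carries the product charts. -/
def IsSmoothMul (K : Type v) [CommRing K] [TopologicalSpace K]
    (E : Type u) [AddCommGroup E] [Module K E] [TopologicalSpace E]
    {M : Type w} [TopologicalSpace M] [ChartedSpace E M] (m : M → M → M) : Prop :=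
  Continuous (fun p : M × M => m p.1 p.2) ∧
    ∀ e₁ ∈ atlas E M, ∀ e₂ ∈ atlas E M, ∀ e ∈ atlas E M,
      IsSmoothOn K
        {q : E × E | q.1 ∈ e₁.target ∧ q.2 ∈ e₂.target ∧ m (e₁.symm q.1) (e₂.symm q.2) ∈ e.source}
        (fun q : E × E => e (m (e₁.symm q.1) (e₂.symm q.2)))

/-- The tangent map `T_p f : T_p M → T_{f p} M` of a map `f : M → M`. -/
noncomputable def tangentMapAt (K : Type v) [CommRing K] [TopologicalSpace K]
    {E : Type u} [AddCommGroup E] [Module K E] [TopologicalSpace E]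
    {M : Type w} [TopologicalSpace M] [ChartedSpace E M]
    (f : M → M) (p : M) (δ : E) : E :=
  differential K
    {y : E | y ∈ (chartAt E p).target ∧ f ((chartAt E p).symm y) ∈ (chartAt E (f p)).source}
    (fun y : E => chartAt E (f p) (f ((chartAt E p).symm y)))
    (chartAt E p p) δ

/-- The tangent map `T_{(x,y)} m : T_x M × T_y M → T_{m(x,y)} M` of a binary map. -/
noncomputable def tangentMulAt (K : Type v) [CommRing K] [TopologicalSpace K]
    {E : Type u} [AddCommGroup E] [Module K E] [TopologicalSpace E]
    {M : Type w} [TopologicalSpace M] [ChartedSpace E M]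
    (m : M → M → M) (x y : M) (δx δy : E) : E :=
  differential K
    {q : E × E | q.1 ∈ (chartAt E x).target ∧ q.2 ∈ (chartAt E y).target ∧
      m ((chartAt E x).symm q.1) ((chartAt E y).symm q.2) ∈ (chartAt E (m x y)).source}
    (fun q : E × E =>
      chartAt E (m x y) (m ((chartAt E x).symm q.1) ((chartAt E y).symm q.2)))
    (chartAt E x x, chartAt E y y) (δx, δy)

/-- The representation in a chart `e` of a vector field `X` (a section of the tangent bundle, whose
value at `p` is given in the preferred chart at `p`). -/
noncomputable def vectorFieldInChart (K : Type v) [CommRing K] [TopologicalSpace K]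
    {E : Type u} [AddCommGroup E] [Module K E] [TopologicalSpace E]
    {M : Type w} [TopologicalSpace M] [ChartedSpace E M]
    (e : OpenPartialHomeomorph M E) (X : M → E) (y : E) : E :=
  differential K ((chartAt E (e.symm y)).symm.trans e).source ((chartAt E (e.symm y)).symm.trans e)
    (chartAt E (e.symm y) (e.symm y)) (X (e.symm y))

/-- The Lie bracket of vector fields, in a chart `[X, Y](y) = dY(y)X(y) - dX(y)Y(y)`. -/
noncomputable def vectorFieldBracket (K : Type v) [CommRing K] [TopologicalSpace K]
    {E : Type u} [AddCommGroup E] [Module K E] [TopologicalSpace E]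
    {M : Type w} [TopologicalSpace M] [ChartedSpace E M]
    (X Y : M → E) (p : M) : E :=
  let c := chartAt E p
  let X' := vectorFieldInChart K c X
  let Y' := vectorFieldInChart K c Y
  differential K c.target Y' (c p) (X' (c p)) - differential K c.target X' (c p) (Y' (c p))

end Manifolds

/-! ### Symmetric spaces -/

section SymmetricSpaces

/-- `(M, m)` is a symmetric space over `K` (modelled on `E`). -/
structure IsSymmetricSpace (K : Type v) [CommRing K] [TopologicalSpace K]
    (E : Type u) [AddCommGroup E] [Module K E] [TopologicalSpace E]
    {M : Type w} [TopologicalSpace M] [ChartedSpace E M] (m : M → M → M) : Prop where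
  isSmoothManifold : IsSmoothManifold K E M
  isSmoothMul : IsSmoothMul K E m
  mul_self : ∀ x, m x x = x
  mul_mul_cancel : ∀ x y, m x (m x y) = y
  mul_mul_distrib : ∀ x y z, m x (m y z) = m (m x y) (m x z)
  tangentMap_symmetry : ∀ (x : M) (δ : E), tangentMapAt K (m x) x δ = -δ

namespace IsSymmetricSpace

/-- The symmetry `σ_x : y ↦ m(x, y)`. -/
def symmetry {K : Type v} [CommRing K] [TopologicalSpace K]
    {E : Type u} [AddCommGroup E] [Module K E] [TopologicalSpace E]
    {M : Type w} [TopologicalSpace M] [ChartedSpace E M] {m : M → M → M}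
    (h : IsSymmetricSpace K E m) (x : M) : Equiv.Perm M :=
  ⟨m x, m x, h.mul_mul_cancel x, h.mul_mul_cancel x⟩

/-- The group of displacements `G(M)`, generated by all products `σ_x σ_y`. -/
def displacementGroup {K : Type v} [CommRing K] [TopologicalSpace K]
    {E : Type u} [AddCommGroup E] [Module K E] [TopologicalSpace E]
    {M : Type w} [TopologicalSpace M] [ChartedSpace E M] {m : M → M → M}
    (h : IsSymmetricSpace K E m) : Subgroup (Equiv.Perm M) :=
  Subgroup.closure {g | ∃ x y : M, g = h.symmetry x * h.symmetry y}

/-- The quadratic representation `M → G(M)`, `x ↦ σ_x σ_o`, with respect to a base point `o`. -/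
def quadraticRep {K : Type v} [CommRing K] [TopologicalSpace K]
    {E : Type u} [AddCommGroup E] [Module K E] [TopologicalSpace E]
    {M : Type w} [TopologicalSpace M] [ChartedSpace E M] {m : M → M → M}
    (h : IsSymmetricSpace K E m) (o x : M) : h.displacementGroup :=
  ⟨h.symmetry x * h.symmetry o, Subgroup.subset_closure ⟨x, o, rfl⟩⟩

end IsSymmetricSpace

/-- For `δ ∈ T_o M`, the vector field `p ↦ ½ Tm(δ, Tm(0_o, 0_p))` on a symmetric space; it is the
derivation of `M`, odd under the symmetry `σ_o`, with value `δ` at `o`. -/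
noncomputable def oddDerivation (K : Type v) [CommRing K] [TopologicalSpace K] [Invertible (2 : K)]
    {E : Type u} [AddCommGroup E] [Module K E] [TopologicalSpace E]
    {M : Type w} [TopologicalSpace M] [ChartedSpace E M]
    (m : M → M → M) (o : M) (δ : E) (p : M) : E :=
  (⅟2 : K) • tangentMulAt K m o (m o p) δ (tangentMulAt K m o p (0 : E) 0)

/-- The triple bracket `[x, y, z] = [[x̃, ỹ], z̃](o)` of the Lie triple system on `T_o M` associated
to the symmetric space `M` with base point `o`. -/
noncomputable def tripleBracket (K : Type v) [CommRing K] [TopologicalSpace K] [Invertible (2 : K)]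
    {E : Type u} [AddCommGroup E] [Module K E] [TopologicalSpace E]
    {M : Type w} [TopologicalSpace M] [ChartedSpace E M]
    (m : M → M → M) (o : M) (x y z : E) : E :=
  vectorFieldBracket K
    (vectorFieldBracket K (oddDerivation K m o x) (oddDerivation K m o y))
    (oddDerivation K m o z) o

/-- The curvature `R_o`, defined by `[x, y, z] = -R_o(x, y)z`. -/
noncomputable def curvature (K : Type v) [CommRing K] [TopologicalSpace K] [Invertible (2 : K)]
    {E : Type u} [AddCommGroup E] [Module K E] [TopologicalSpace E]
    {M : Type w} [TopologicalSpace M] [ChartedSpace E M]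
    (m : M → M → M) (o : M) (x y z : E) : E :=
  -tripleBracket K m o x y z

end SymmetricSpaces

/-! ### Continuous inverse Jordan algebras

A unital Jordan algebra over `K` is given by `[NonAssocCommRing V] [IsCommJordan V] [Module K V]
[IsScalarTower K V V] [SMulCommClass K V V]`. -/

section Jordan

/-- `L(x)y = x • y`. -/
def jordanL (K : Type v) [CommRing K] {V : Type u} [NonAssocCommRing V] [Module K V]
    [SMulCommClass K V V] (x : V) : Module.End K V :=
  LinearMap.mulLeft K x

/-- `Q(x) = 2 L(x)² - L(x²)`. -/
def jordanQ (K : Type v) [CommRing K] {V : Type u} [NonAssocCommRing V] [Module K V]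
    [SMulCommClass K V V] (x : V) : Module.End K V :=
  2 * jordanL K x ^ 2 - jordanL K (x * x)

/-- The set `V^×` of invertible elements: those `x` for which `Q(x)` is invertible. -/
abbrev JordanUnits (K : Type v) [CommRing K] (V : Type u) [NonAssocCommRing V] [Module K V]
    [SMulCommClass K V V] : Type u :=
  {x : V // IsUnit (jordanQ K x)}

/-- The Jordan inverse `x⁻¹ = Q(x)⁻¹ x` (meant for `x ∈ V^×`). -/
noncomputable def jordanInv (K : Type v) [CommRing K] {V : Type u} [NonAssocCommRing V] [Module K V]
    [SMulCommClass K V V] (x : V) : V :=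
  Ring.inverse (jordanQ K x) x

/-- `V` (a topological Jordan algebra over `K`) is a continuous inverse Jordan algebra. -/
class ContinuousInverseJordan (K : Type v) [CommRing K] (V : Type u) [NonAssocCommRing V]
    [Module K V] [SMulCommClass K V V] [TopologicalSpace V] : Prop where
  isOpen_units : IsOpen {x : V | IsUnit (jordanQ K x)}
  continuousOn_inv : ContinuousOn (jordanInv K) {x : V | IsUnit (jordanQ K x)}

theorem jordanQ_one (K : Type v) [CommRing K] (V : Type u) [NonAssocCommRing V] [Module K V]
    [SMulCommClass K V V] : jordanQ K (1 : V) = 1 := by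
  ext y
  simp [jordanQ, jordanL, pow_two, two_mul]

/-- The base point `1 ∈ V^×`. -/
instance JordanUnits.instOne (K : Type v) [CommRing K] (V : Type u) [NonAssocCommRing V]
    [Module K V] [SMulCommClass K V V] : One (JordanUnits K V) :=
  ⟨⟨1, by rw [jordanQ_one]; exact isUnit_one⟩⟩

/-- `V^×` is a manifold modelled on `V`, as an open subset of `V`: the inclusion is the only
chart. -/
noncomputable instance JordanUnits.instChartedSpace (K : Type v) [CommRing K] (V : Type u)
    [NonAssocCommRing V] [Module K V] [SMulCommClass K V V] [TopologicalSpace V]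
    [ContinuousInverseJordan K V] : ChartedSpace V (JordanUnits K V) :=
  haveI : Nonempty (JordanUnits K V) := ⟨1⟩
  Topology.IsOpenEmbedding.singletonChartedSpace (f := (Subtype.val : JordanUnits K V → V))
    (ContinuousInverseJordan.isOpen_units (K := K) (V := V)).isOpenEmbedding_subtypeVal

end Jordan

/-!
The algebra rests on the fundamental formula `Q(Q(x)y) = Q(x)Q(y)Q(x)` (`jordanQ_jordanQ`).  With
`D(x, y) = L(xy) + [L(x), L(y)]`, it follows from the five-linear identity for `[D(x, y), D(u, v)]`
(`lie_jordanD`) and from `D(x, y)Q(x) = Q(x)D(y, x)` (`jordanD_mul_jordanQ`); both are consequences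
of the linearized Jordan identity that only need division by two.  The formula gives
`Q(x⁻¹) = Q(x)⁻¹` and `(Q(x)y)⁻¹ = Q(x)⁻¹y⁻¹`, hence the algebraic axioms of a symmetric space for
`m(x, y) = Q(x)y⁻¹`, and `σ_x σ_1 = Q(x)` on the invertible elements.

For smoothness, the identity `D(x, x⁻¹) = 1` yields an explicit difference quotient
`(x + tv)⁻¹ - x⁻¹ = t Q(x⁻¹)(t Q(v)(x + tv)⁻¹ - v)` (`jordanInv_add_smul_sub`).  Thus the functions
built from continuous linear maps by algebra operations and Jordan inversion have difference
quotients of the same kind (`JordanRational.exists_slope`).  They are continuous, so by induction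
they are of class `C^k` for all `k`, without any appeal to a chain rule.

Because the units of `K` are dense, the differential can be read off from any continuous difference
quotient (`IsSlope.differential_eq`).  At `(x, x)` this gives `T_x(σ_x) = -id`, and it shows that the
odd derivation with value `u` at `1` is the linear vector field `L(u)`.  Brackets of linear vector
fields are commutators up to sign, so the triple bracket at `1` is `[[L(x), L(y)], L(z)]1`.
-/

open Filter Topology

/-! ### Operator identities and the fundamental formula -/

section JordanIdentities

variable {K : Type v} [CommRing K] {V : Type u} [NonAssocCommRing V]
  [Module K V] [SMulCommClass K V V]

theorem eq_of_add_self_eq (K : Type v) [CommRing K] [Invertible (2 : K)] {M : Type*}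
    [AddCommGroup M] [Module K M] {a b : M} (h : a + a = b + b) : a = b := by
  rw [← two_smul K, ← two_smul K] at h
  simpa using congrArg (fun z => (⅟2 : K) • z) h

theorem jordanL_apply (x y : V) : jordanL K x y = x * y := rfl

theorem jordanL_add (x y : V) : jordanL K (x + y) = jordanL K x + jordanL K y := by
  ext z; simp [jordanL_apply, add_mul]

theorem jordanL_sub (x y : V) : jordanL K (x - y) = jordanL K x - jordanL K y := by
  ext z; simp [jordanL_apply, sub_mul]

theorem jordanQ_apply (x y : V) : jordanQ K x y = 2 • (x * (x * y)) - (x * x) * y := by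
  simp [jordanQ, jordanL_apply, pow_two, two_mul, two_smul]

/-- The operator `D(x, y) = L(xy) + [L(x), L(y)]`.  The normalization is such that
`D(x, y)x = Q(x)y`, so that `D(x, y)z` is half of the usual Jordan triple product `{x y z}`. -/
def jordanD (K : Type v) [CommRing K] {V : Type u} [NonAssocCommRing V] [Module K V]
    [SMulCommClass K V V] (x y : V) : Module.End K V :=
  jordanL K (x * y) + ⁅jordanL K x, jordanL K y⁆

/-- The symmetric bilinear operator `P(x, z)y = D(x, y)z`, with `P(x, x) = Q(x)`. -/
def jordanP (K : Type v) [CommRing K] {V : Type u} [NonAssocCommRing V] [Module K V]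
    [SMulCommClass K V V] (x z : V) : Module.End K V :=
  jordanL K x * jordanL K z + jordanL K z * jordanL K x - jordanL K (x * z)

theorem jordanD_apply (x y z : V) :
    jordanD K x y z = (x * y) * z + x * (y * z) - y * (x * z) := by
  simp only [jordanD, Ring.lie_def, LinearMap.add_apply, LinearMap.sub_apply, Module.End.mul_apply,
    jordanL_apply]
  abel

theorem jordanP_apply (x z y : V) :
    jordanP K x z y = x * (z * y) + z * (x * y) - (x * z) * y := by
  simp only [jordanP, LinearMap.add_apply, LinearMap.sub_apply, Module.End.mul_apply,
    jordanL_apply]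

theorem jordanD_apply_eq_jordanP (x y z : V) : jordanD K x y z = jordanP K x z y := by
  rw [jordanD_apply, jordanP_apply]
  simp only [mul_comm]
  abel

theorem jordanP_comm (x z : V) : jordanP K x z = jordanP K z x := by
  rw [jordanP, jordanP, mul_comm x z, add_comm (jordanL K x * _)]

theorem jordanP_self (x : V) : jordanP K x x = jordanQ K x := by
  rw [jordanP, jordanQ]
  noncomm_ring

theorem jordanD_apply_self (x y : V) : jordanD K x y x = jordanQ K x y := by
  rw [jordanD_apply_eq_jordanP, jordanP_self]

theorem jordanD_apply_swap (x y z : V) : jordanD K x y z = jordanD K z y x := by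
  rw [jordanD_apply, jordanD_apply]
  simp only [mul_comm]
  abel

/-- The full linearization of the Jordan identity.  Its right-hand side is symmetric in all four
variables. -/
theorem jordan_linearized (K : Type v) [CommRing K] [Invertible (2 : K)] {V : Type u}
    [NonAssocCommRing V] [IsCommJordan V] [Module K V] (a b c d : V) :
    a * ((b * c) * d) + b * ((c * a) * d) + c * ((a * b) * d) =
      (b * c) * (a * d) + (c * a) * (b * d) + (a * b) * (c * d) := by
  have h := DFunLike.congr_fun (two_nsmul_lie_lmul_lmul_add_add_eq_zero (A := V) a b c) d
  have h' : ∀ e : V, e = (a * ((b * c) * d) - (b * c) * (a * d)) +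
      (b * ((c * a) * d) - (c * a) * (b * d)) + (c * ((a * b) * d) - (a * b) * (c * d)) →
      e + e = 0 := by
    rintro e rfl
    rw [two_nsmul] at h
    exact h
  apply eq_of_add_self_eq K
  rw [← sub_eq_zero, ← h' _ rfl]
  abel

variable [Invertible (2 : K)] [IsCommJordan V]

/-- One reading of the linearized Jordan identity, as operators in the fourth variable. -/
theorem jordanL_commutator_cyclic (a b c : V) :
    ⁅jordanL K a, jordanL K (b * c)⁆ + ⁅jordanL K b, jordanL K (c * a)⁆ +
      ⁅jordanL K c, jordanL K (a * b)⁆ = 0 := by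
  ext d
  simp only [Ring.lie_def, LinearMap.add_apply, LinearMap.sub_apply, Module.End.mul_apply,
    jordanL_apply, LinearMap.zero_apply]
  have h := jordan_linearized K a b c d
  rw [← sub_eq_zero] at h
  rw [← h]
  abel

/-- The reading of the linearized Jordan identity as operators in one of the variables `a`, `b`, `c`
of `jordan_linearized`; these play the same role as `d`, by the symmetry of the right-hand side. -/
theorem jordanL_mul_mul (a b c : V) :
    jordanL K ((a * b) * c) + jordanL K a * jordanL K c * jordanL K b +
        jordanL K b * jordanL K c * jordanL K a =
      jordanL K (a * b) * jordanL K c + jordanL K (b * c) * jordanL K a +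
        jordanL K (c * a) * jordanL K b := by
  ext d
  simp only [LinearMap.add_apply, Module.End.mul_apply, jordanL_apply]
  have h := jordan_linearized K a b d c
  simp only [mul_comm] at h ⊢
  rw [← sub_eq_zero] at h ⊢
  rw [← h]
  abel

/-- Commutators of multiplications are derivations of the Jordan algebra. -/
theorem lie_lie_jordanL (a b c : V) :
    ⁅⁅jordanL K a, jordanL K b⁆, jordanL K c⁆ = jordanL K (a * (b * c) - b * (a * c)) := by
  have h₁ := jordanL_mul_mul (K := K) b c a
  have h₂ := jordanL_mul_mul (K := K) a c b
  rw [mul_comm (b * c)] at h₁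
  rw [mul_comm (a * c), mul_comm a c, mul_comm c b, mul_comm b a] at h₂
  rw [mul_comm c a] at h₁
  rw [mul_comm c a] at h₂
  have h : jordanL K (a * (b * c)) - jordanL K (b * (a * c)) =
      (jordanL K a * jordanL K b * jordanL K c + jordanL K c * jordanL K b * jordanL K a) -
      (jordanL K b * jordanL K a * jordanL K c + jordanL K c * jordanL K a * jordanL K b) := by
    rw [eq_sub_of_add_eq (eq_sub_of_add_eq h₁), eq_sub_of_add_eq (eq_sub_of_add_eq h₂)]
    abel
  rw [jordanL_sub, h, Ring.lie_def, Ring.lie_def]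
  noncomm_ring

/-- The five-linear identity of the Jordan triple product. -/
theorem lie_jordanD (x y u v : V) :
    ⁅jordanD K x y, jordanD K u v⁆ =
      jordanD K (jordanD K x y u) v - jordanD K u (jordanD K y x v) := by
  have hmul : ∀ a : V, ⁅jordanL K a, jordanD K u v⁆ = jordanD K (a * u) v - jordanD K u (a * v) := by
    intro a
    have h₁ := jordanL_commutator_cyclic (K := K) a u v
    have h₂ := lie_lie_jordanL (K := K) u v a
    rw [mul_comm v a, mul_comm u a, mul_comm v (a * u), jordanL_sub] at h₂
    rw [mul_comm v a] at h₁
    simp only [jordanD, Ring.lie_def] at h₁ h₂ ⊢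
    rw [← sub_eq_zero] at h₂ ⊢
    rw [← sub_zero (0 : Module.End K V)]
    nth_rewrite 1 [← h₁]
    rw [← h₂]
    noncomm_ring
  -- `D(x, y)` is the sum of a multiplication and the derivation `d`, `D(y, x)` their difference.
  obtain ⟨d, hd⟩ : ∃ d, d = ⁅jordanL K x, jordanL K y⁆ := ⟨_, rfl⟩
  have hder : ∀ a : V, ⁅d, jordanL K a⁆ = jordanL K (d a) := fun a => by
    rw [hd]; exact lie_lie_jordanL x y a
  have hleib : ∀ a b : V, d (a * b) = d a * b + a * d b := by
    intro a b
    have h := DFunLike.congr_fun (hder a) b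
    rw [Ring.lie_def, LinearMap.sub_apply, Module.End.mul_apply,
      Module.End.mul_apply, jordanL_apply, jordanL_apply, jordanL_apply] at h
    rw [← h]
    abel
  have hlie : ⁅d, jordanD K u v⁆ = jordanD K (d u) v + jordanD K u (d v) := by
    have h := hder (u * v)
    rw [hleib, jordanL_add, Ring.lie_def, ← sub_eq_zero] at h
    simp only [jordanD, ← hder, Ring.lie_def]
    rw [← sub_eq_zero, ← h]
    noncomm_ring
  have hadd : ∀ a b c : V, jordanD K (a + b) c = jordanD K a c + jordanD K b c := by
    intro a b c
    simp only [jordanD, add_mul a, jordanL_add, Ring.lie_def]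
    noncomm_ring
  have hsub : ∀ a b c : V, jordanD K a (b - c) = jordanD K a b - jordanD K a c := by
    intro a b c
    simp only [jordanD, mul_sub a, jordanL_sub, Ring.lie_def]
    noncomm_ring
  have hyx : jordanD K y x = jordanL K (x * y) - d := by
    rw [jordanD, hd, mul_comm y x, Ring.lie_def, Ring.lie_def]
    abel
  have hxy : jordanD K x y = jordanL K (x * y) + d := by rw [jordanD, hd]
  have hsplit : ⁅jordanL K (x * y) + d, jordanD K u v⁆ =
      ⁅jordanL K (x * y), jordanD K u v⁆ + ⁅d, jordanD K u v⁆ := by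
    simp only [Ring.lie_def]
    noncomm_ring
  rw [hyx, hxy, hsplit, hlie, hmul, LinearMap.add_apply, LinearMap.sub_apply, hadd, hsub,
    jordanL_apply, jordanL_apply]
  abel

/-- The commutation rule of degree three in `x`.  Deriving it from the five-linear identity would
require division by three, so it is obtained from the linearized Jordan identity directly. -/
theorem jordanD_mul_jordanQ (x y : V) :
    jordanD K x y * jordanQ K x = jordanQ K x * jordanD K y x := by
  have h₁ := jordanL_commutator_cyclic (K := K) x x y
  have h₂ := jordanL_commutator_cyclic (K := K) x x (x * y)
  have h₃ := jordanL_mul_mul (K := K) x y x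
  have h₄ : jordanL K x * jordanL K (x * x) - jordanL K (x * x) * jordanL K x = 0 := by
    rw [sub_eq_zero]
    ext z
    exact DFunLike.congr_fun (commute_lmul_lmul_sq x).eq z
  rw [mul_comm (x * y) x] at h₂ h₃
  rw [mul_comm y x] at h₁ h₃
  rw [eq_sub_of_add_eq (eq_sub_of_add_eq h₃)] at h₂
  simp only [jordanD, ← jordanP_self, jordanP, mul_comm y x, Ring.lie_def] at h₁ h₂ h₄ ⊢
  generalize jordanL K (x * y) = T at *
  generalize jordanL K (x * x) = S at *
  generalize jordanL K x = A at *
  generalize jordanL K y = B at *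
  -- `D(x, y)Q(x) - Q(x)D(y, x)` is `h₁ A - A h₁ - h₂ + B h₄ + h₄ B`.
  have h := congrArg₂ (· - ·) (congrArg₂ (· - ·) (congrArg (· * A) h₁) (congrArg (A * ·) h₁)) h₂
  have h' := congrArg₂ (· + ·) h
    (congrArg₂ (· + ·) (congrArg (B * ·) h₄) (congrArg (· * B) h₄))
  simp only [mul_zero, zero_mul, sub_zero, add_zero] at h'
  rw [← sub_eq_zero, ← h']
  noncomm_ring

/-- The five-linear identity `lie_jordanD`, evaluated at `w` and read as an operator in `v`, with
`u = z`. -/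
theorem jordanD_mul_jordanP (x y z w : V) :
    jordanD K x y * jordanP K z w + jordanP K z w * jordanD K y x =
      jordanP K (jordanD K x y z) w + jordanP K z (jordanD K x y w) := by
  ext v
  have h := DFunLike.congr_fun (lie_jordanD (K := K) x y z v) w
  simp only [Ring.lie_def, LinearMap.sub_apply, Module.End.mul_apply] at h
  simp only [LinearMap.add_apply, Module.End.mul_apply, ← jordanD_apply_eq_jordanP]
  rw [sub_eq_sub_iff_add_eq_add] at h
  rw [h]

/-- The case `z = w = x` of `jordanD_mul_jordanP`. -/
theorem jordanP_jordanQ (x y : V) :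
    jordanP K x (jordanQ K x y) = jordanQ K x * jordanD K y x := by
  have h := jordanD_mul_jordanP (K := K) x y x x
  rw [jordanP_self, jordanD_apply_self, jordanD_mul_jordanQ,
    jordanP_comm (jordanQ K x y) x] at h
  exact (eq_of_add_self_eq K h).symm

/-- This is `jordanD_mul_jordanP` for `D(z, x)` and `P(y, y)`, evaluated at `x` and read as an
operator in `z`. -/
theorem jordanD_mul_self (x y : V) :
    jordanD K y x * jordanD K y x + jordanD K y x * jordanD K y x =
      jordanD K (jordanQ K y x) x + jordanQ K y * jordanQ K x := by
  ext z
  have h := DFunLike.congr_fun (jordanD_mul_jordanP (K := K) z x y y) x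
  rw [jordanP_self, jordanP_comm y, LinearMap.add_apply, LinearMap.add_apply, Module.End.mul_apply,
    Module.End.mul_apply, jordanD_apply_self, ← jordanD_apply_eq_jordanP, jordanD_apply_swap z x y,
    jordanD_apply_swap z x, jordanD_apply_swap _ x y] at h
  exact h.symm

/-- The fundamental formula.  It results from `jordanD_mul_jordanP` at `z = x`, `w = Q(x)y`, where
the terms quadratic in `D(y, x)` are eliminated by `jordanD_mul_self`. -/
theorem jordanQ_jordanQ (x y : V) :
    jordanQ K (jordanQ K x y) = jordanQ K x * jordanQ K y * jordanQ K x := by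
  have h := jordanD_mul_jordanP (K := K) x y x (jordanQ K x y)
  have hD : jordanD K x y (jordanQ K x y) = jordanQ K x (jordanQ K y x) := by
    rw [← Module.End.mul_apply, jordanD_mul_jordanQ, Module.End.mul_apply, jordanD_apply_self]
  rw [jordanD_apply_self, hD, jordanP_jordanQ, jordanP_jordanQ, jordanP_self, ← mul_assoc,
    jordanD_mul_jordanQ, mul_assoc, ← mul_add, jordanD_mul_self, mul_add, add_comm] at h
  rw [← add_right_cancel h, mul_assoc]

end JordanIdentities

/-! ### Polarization and Jordan inverses -/

section JordanInverse

variable {K : Type v} [CommRing K] {V : Type u} [NonAssocCommRing V]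
  [Module K V] [SMulCommClass K V V]

theorem jordanQ_smul [IsScalarTower K V V] (a : K) (x : V) :
    jordanQ K (a • x) = (a * a) • jordanQ K x := by
  ext y
  simp [jordanQ_apply, smul_mul_assoc, mul_smul_comm, smul_smul, smul_sub, smul_add, two_smul]

theorem jordanP_add_left (x y z : V) : jordanP K (x + y) z = jordanP K x z + jordanP K y z := by
  ext v
  simp only [jordanP_apply, LinearMap.add_apply, add_mul, mul_add]
  abel

theorem jordanP_smul_left [IsScalarTower K V V] (a : K) (x z : V) :
    jordanP K (a • x) z = a • jordanP K x z := by
  ext v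
  simp [jordanP_apply, smul_mul_assoc, mul_smul_comm, smul_sub, smul_add]

theorem jordanQ_add (x y : V) :
    jordanQ K (x + y) = jordanQ K x + jordanQ K y + (2 : K) • jordanP K x y := by
  simp only [← jordanP_self, two_smul]
  rw [jordanP_add_left, jordanP_comm _ (x + y), jordanP_comm _ (x + y), jordanP_add_left,
    jordanP_add_left, jordanP_comm y x]
  abel

theorem jordanQ_add_smul_apply [IsScalarTower K V V] (x v y : V) (t : K) :
    jordanQ K (x + t • v) y =
      jordanQ K x y + t • ((2 : K) • jordanP K x v y + t • jordanQ K v y) := by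
  rw [jordanQ_add, jordanQ_smul, jordanP_comm, jordanP_smul_left, jordanP_comm v x]
  simp only [LinearMap.add_apply, LinearMap.smul_apply, smul_add, smul_smul, mul_comm (2 : K)]
  abel

theorem jordanP_one_apply (x y : V) : jordanP K 1 x y = x * y := by
  simp [jordanP_apply]

/-- The quadratic map `Q : V → End(V)`. -/
def jordanQuadraticMap (K : Type v) [CommRing K] (V : Type u) [NonAssocCommRing V]
    [Module K V] [SMulCommClass K V V] [IsScalarTower K V V] :
    QuadraticMap K V (Module.End K V) where
  toFun := jordanQ K
  toFun_smul := jordanQ_smul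
  exists_companion' :=
    ⟨LinearMap.mk₂ K (fun x y => (2 : K) • jordanP K x y)
      (fun x y z => by rw [jordanP_add_left, smul_add])
      (fun a x z => by rw [jordanP_smul_left, smul_comm])
      (fun x y z => by rw [jordanP_comm, jordanP_add_left, smul_add, jordanP_comm y, jordanP_comm z])
      (fun a x z => by rw [jordanP_comm, jordanP_smul_left, smul_comm, jordanP_comm z]),
      fun x y => jordanQ_add x y⟩

theorem inverse_jordanQ_apply_jordanQ {x : V} (hx : IsUnit (jordanQ K x)) (y : V) :
    Ring.inverse (jordanQ K x) (jordanQ K x y) = y := by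
  rw [← Module.End.mul_apply, Ring.inverse_mul_cancel _ hx, Module.End.one_apply]

theorem jordanQ_apply_inverse_jordanQ {x : V} (hx : IsUnit (jordanQ K x)) (y : V) :
    jordanQ K x (Ring.inverse (jordanQ K x) y) = y := by
  rw [← Module.End.mul_apply, Ring.mul_inverse_cancel _ hx, Module.End.one_apply]

theorem jordanQ_apply_jordanInv {x : V} (hx : IsUnit (jordanQ K x)) :
    jordanQ K x (jordanInv K x) = x :=
  jordanQ_apply_inverse_jordanQ hx x

variable [Invertible (2 : K)] [IsCommJordan V]

theorem jordanQ_jordanInv {x : V} (hx : IsUnit (jordanQ K x)) :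
    jordanQ K (jordanInv K x) = Ring.inverse (jordanQ K x) := by
  have h := jordanQ_jordanQ (K := K) x (jordanInv K x)
  rw [jordanQ_apply_jordanInv hx] at h
  calc jordanQ K (jordanInv K x)
      = Ring.inverse (jordanQ K x) *
          (jordanQ K x * jordanQ K (jordanInv K x) * jordanQ K x) *
          Ring.inverse (jordanQ K x) := by
        rw [mul_assoc, mul_assoc, Ring.mul_inverse_cancel _ hx, mul_one, ← mul_assoc,
          Ring.inverse_mul_cancel _ hx, one_mul]
    _ = Ring.inverse (jordanQ K x) := by
        rw [← h, Ring.inverse_mul_cancel _ hx, one_mul]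

theorem isUnit_jordanQ_jordanInv {x : V} (hx : IsUnit (jordanQ K x)) :
    IsUnit (jordanQ K (jordanInv K x)) := by
  rw [jordanQ_jordanInv hx]
  exact hx.ringInverse

theorem jordanInv_jordanInv {x : V} (hx : IsUnit (jordanQ K x)) :
    jordanInv K (jordanInv K x) = x := by
  rw [jordanInv, jordanQ_jordanInv hx, Ring.inverse_inverse hx, jordanQ_apply_jordanInv hx]

theorem isUnit_jordanQ_jordanQ {x y : V} (hx : IsUnit (jordanQ K x)) (hy : IsUnit (jordanQ K y)) :
    IsUnit (jordanQ K (jordanQ K x y)) := by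
  rw [jordanQ_jordanQ]
  exact (hx.mul hy).mul hx

theorem jordanInv_jordanQ {x y : V} (hx : IsUnit (jordanQ K x)) (hy : IsUnit (jordanQ K y)) :
    jordanInv K (jordanQ K x y) = Ring.inverse (jordanQ K x) (jordanInv K y) := by
  have h : jordanQ K (jordanQ K x y) (Ring.inverse (jordanQ K x) (jordanInv K y)) =
      jordanQ K x y := by
    rw [jordanQ_jordanQ, Module.End.mul_apply, Module.End.mul_apply,
      jordanQ_apply_inverse_jordanQ hx, jordanQ_apply_jordanInv hy]
  rw [jordanInv, ← inverse_jordanQ_apply_jordanQ (isUnit_jordanQ_jordanQ hx hy)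
    (Ring.inverse (jordanQ K x) (jordanInv K y)), h]

/-- Cancel `Q(x)` in `P(x, Q(x)w) = D(x, w)Q(x)` at `w = x⁻¹`, where the left-hand side is `Q(x)`. -/
theorem jordanD_self_jordanInv {x : V} (hx : IsUnit (jordanQ K x)) :
    jordanD K x (jordanInv K x) = 1 := by
  have h := jordanP_jordanQ (K := K) x (jordanInv K x)
  rw [jordanQ_apply_jordanInv hx, jordanP_self, ← jordanD_mul_jordanQ] at h
  exact (hx.mul_right_cancel (h.symm.trans (one_mul _).symm))

/-- The difference quotient of the Jordan inverse.  It comes from expanding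
`Q(y - t v) y⁻¹` for `y = x + t v`, where the linear term is `-2t D(y, y⁻¹)v = -2t v`. -/
theorem jordanInv_add_smul_sub [IsScalarTower K V V] {x v : V} {t : K} (hx : IsUnit (jordanQ K x))
    (hy : IsUnit (jordanQ K (x + t • v))) :
    jordanInv K (x + t • v) - jordanInv K x =
      t • jordanQ K (jordanInv K x) (t • jordanQ K v (jordanInv K (x + t • v)) - v) := by
  obtain ⟨y, rfl⟩ : ∃ y, x = y + (-t) • v := ⟨x + t • v, by simp⟩
  have hyv : y + (-t) • v + t • v = y := by simp
  rw [hyv] at hy ⊢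
  have h := jordanQ_add_smul_apply (K := K) y v (jordanInv K y) (-t)
  rw [jordanQ_apply_jordanInv hy, ← jordanD_apply_eq_jordanP, jordanD_self_jordanInv hy,
    Module.End.one_apply] at h
  rw [← map_smul, jordanQ_jordanInv hx]
  have h' := inverse_jordanQ_apply_jordanQ hx (jordanInv K y)
  rw [h] at h'
  generalize jordanInv K y = w at h' ⊢
  nth_rewrite 1 [← h']
  rw [jordanInv, ← map_sub]
  congr 1
  simp only [smul_add, smul_sub, two_smul, neg_smul, smul_neg]
  abel

end JordanInverse

/-! ### Differentials from difference quotients -/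

section Differential

variable {K : Type v} [CommRing K] [TopologicalSpace K]
  {E : Type u} [AddCommGroup E] [Module K E] [TopologicalSpace E]
  {W : Type w} [AddCommGroup W] [Module K W] [TopologicalSpace W]

/-- Any difference quotient computes the differential.  By density of the units, two difference
quotients agree at `t = 0` because they agree for invertible `t`. -/
theorem IsSlope.differential_eq [HasDenseOpenUnits K] [ContinuousAdd E] [ContinuousSMul K E]
    [T2Space W] {U : Set E} (hU : IsOpen U) {f : E → W} {g : E × E × K → W}
    (hg : IsSlope K U f g) {x : E} (hx : x ∈ U) (v : E) :
    differential K U f x v = g (x, v, 0) := by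
  have hex : ∃ g : E × E × K → W, IsSlope K U f g := ⟨g, hg⟩
  rw [differential, dif_pos hex]
  have hg' := hex.choose_spec
  generalize hex.choose = g' at hg'
  have : (𝓝[{a : K | IsUnit a}] (0 : K)).NeBot :=
    mem_closure_iff_nhdsWithin_neBot.mp (HasDenseOpenUnits.dense_units 0)
  have hmem : (x, v, (0 : K)) ∈ slopeDomain K U := ⟨hx, by simpa using hx⟩
  have hev : ∀ᶠ s in 𝓝[{a : K | IsUnit a}] (0 : K), (x, v, s) ∈ slopeDomain K U := by
    have hcont : Continuous fun s : K => x + s • v := by fun_prop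
    have h0 : ∀ᶠ s in 𝓝 (0 : K), x + s • v ∈ U :=
      hcont.continuousAt.eventually_mem (hU.mem_nhds (by simpa using hx))
    filter_upwards [nhdsWithin_le_nhds h0] with s hs using ⟨hx, hs⟩
  have hlim : ∀ k : E × E × K → W, IsSlope K U f k →
      Tendsto (fun s => k (x, v, s)) (𝓝[{a : K | IsUnit a}] 0) (𝓝 (k (x, v, 0))) := by
    intro k hk
    refine (hk.1 _ hmem).tendsto.comp (tendsto_nhdsWithin_iff.mpr ⟨?_, hev⟩)
    have hcont : Continuous fun s : K => (x, v, s) := by fun_prop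
    exact hcont.continuousAt.tendsto.mono_left nhdsWithin_le_nhds
  refine tendsto_nhds_unique_of_eventuallyEq (hlim g' hg') (hlim g hg) ?_
  filter_upwards [hev, self_mem_nhdsWithin] with s hs hunit
  have h : s • g' (x, v, s) = s • g (x, v, s) := by rw [← hg'.2 x v s hs, ← hg.2 x v s hs]
  exact hunit.smul_left_cancel.mp h

theorem IsSlope.congr {U : Set E} {f f' : E → W} {g : E × E × K → W} (hg : IsSlope K U f g)
    (h : Set.EqOn f f' U) : IsSlope K U f' g :=
  ⟨hg.1, fun x v t hp => by rw [← h hp.1, ← h hp.2, hg.2 x v t hp]⟩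

/-- Freezing the first variable restricts a difference quotient to the directions `(0, v)`. -/
theorem IsSlope.comp_mk_left {F : Type*} [AddCommGroup F] [Module K F] [TopologicalSpace F]
    {U : Set (E × F)} {f : E × F → W} {g : (E × F) × (E × F) × K → W} (hg : IsSlope K U f g)
    (x : E) {U' : Set F} (hU : Set.MapsTo (fun y => (x, y)) U' U) :
    IsSlope K U' (fun y => f (x, y)) fun p => g ((x, p.1), (0, p.2.1), p.2.2) := by
  have hmem : ∀ p ∈ slopeDomain K U', ((x, p.1), (0, p.2.1), p.2.2) ∈ slopeDomain K U :=
    fun p hp => ⟨hU hp.1, by simpa using hU hp.2⟩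
  exact ⟨hg.1.comp (by fun_prop) hmem, fun y v t hp => by simpa using hg.2 _ _ t (hmem _ hp)⟩

theorem isSlope_continuousLinearMap (U : Set E) (l : E →L[K] W) :
    IsSlope K U l fun p => l p.2.1 :=
  ⟨by fun_prop, fun x v t _ => by simp⟩

theorem IsCkAux.congr {E : Type (max u v)} [AddCommGroup E] [Module K E] [TopologicalSpace E]
    {k : ℕ} {U : Set E} {f f' : E → W} (hf : IsCkAux.{u, v, w} K k U f) (h : Set.EqOn f f' U) :
    IsCkAux.{u, v, w} K k U f' := by
  cases k with
  | zero => exact ContinuousOn.congr hf h.symm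
  | succ k =>
    obtain ⟨g, hg, hk⟩ := hf
    exact ⟨g, hg.congr h, hk⟩

end Differential

/-! ### Smoothness of Jordan rational functions -/

section JordanRational

/-- The `V`-valued functions on a subset `U` of a topological module `X` that are built from
continuous linear maps by the algebra operations of `V`, multiplication by continuous linear
functionals, and Jordan inversion of functions with invertible values on `U`. -/
inductive JordanRational (K : Type v) [CommRing K] [TopologicalSpace K]
    {V : Type u} [NonAssocCommRing V] [Module K V] [SMulCommClass K V V] [TopologicalSpace V]
    {X : Type w} [AddCommGroup X] [Module K X] [TopologicalSpace X] (U : Set X) : (X → V) → Prop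
  | clm (l : X →L[K] V) : JordanRational K U l
  | smul (c : X →L[K] K) {f : X → V} (hf : JordanRational K U f) :
      JordanRational K U fun x => c x • f x
  | add {f g : X → V} (hf : JordanRational K U f) (hg : JordanRational K U g) :
      JordanRational K U fun x => f x + g x
  | sub {f g : X → V} (hf : JordanRational K U f) (hg : JordanRational K U g) :
      JordanRational K U fun x => f x - g x
  | mul {f g : X → V} (hf : JordanRational K U f) (hg : JordanRational K U g) :
      JordanRational K U fun x => f x * g x
  | inv {f : X → V} (hf : JordanRational K U f) (hU : ∀ x ∈ U, IsUnit (jordanQ K (f x))) :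
      JordanRational K U fun x => jordanInv K (f x)

namespace JordanRational

variable {K : Type v} [CommRing K] [TopologicalSpace K]
  {V : Type u} [NonAssocCommRing V] [Module K V] [SMulCommClass K V V] [TopologicalSpace V]
  {X : Type w} [AddCommGroup X] [Module K X] [TopologicalSpace X] {U : Set X}

theorem comp {X' : Type*} [AddCommGroup X'] [Module K X'] [TopologicalSpace X'] {U' : Set X'}
    {f : X → V} (hf : JordanRational K U f) (l : X' →L[K] X) (hl : Set.MapsTo l U' U) :
    JordanRational K U' fun x => f (l x) := by
  induction hf with
  | clm l' => exact .clm (l'.comp l)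
  | smul c _ ih => exact .smul (c.comp l) ih
  | add _ _ ih₁ ih₂ => exact .add ih₁ ih₂
  | sub _ _ ih₁ ih₂ => exact .sub ih₁ ih₂
  | mul _ _ ih₁ ih₂ => exact .mul ih₁ ih₂
  | inv _ hU ih => exact .inv ih fun x hx => hU _ (hl hx)

theorem jordanQ {f g : X → V} (hf : JordanRational K U f) (hg : JordanRational K U g) :
    JordanRational K U fun x => jordanQ K (f x) (g x) := by
  simp only [jordanQ_apply, two_smul]
  have h := hf.mul (hf.mul hg)
  exact (h.add h).sub ((hf.mul hf).mul hg)

theorem continuousOn [IsTopologicalRing V] [ContinuousSMul K V] [ContinuousInverseJordan K V]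
    {f : X → V} (hf : JordanRational K U f) : ContinuousOn f U := by
  induction hf with
  | clm l => exact l.continuous.continuousOn
  | smul c _ ih => exact c.continuous.continuousOn.smul ih
  | add _ _ ih₁ ih₂ => exact ih₁.add ih₂
  | sub _ _ ih₁ ih₂ => exact ih₁.sub ih₂
  | mul _ _ ih₁ ih₂ => exact ih₁.mul ih₂
  | inv _ hU ih => exact ContinuousInverseJordan.continuousOn_inv.comp ih hU

variable [IsScalarTower K V V] [Invertible (2 : K)] [IsCommJordan V]

/-- Jordan rational functions have Jordan rational difference quotients.  In the slopes of products
and inverses, `f (x + t v)` is rewritten as `f x + t g (x, v, t)`, where `g` is the slope of `f`. -/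
theorem exists_slope {f : X → V} (hf : JordanRational K U f) :
    ∃ g : X × X × K → V, JordanRational K (slopeDomain K U) g ∧
      ∀ x v : X, ∀ t : K, (x, v, t) ∈ slopeDomain K U → f (x + t • v) - f x = t • g (x, v, t) := by
  let π₁ : X × X × K →L[K] X := .fst K X (X × K)
  let π₂ : X × X × K →L[K] X := (ContinuousLinearMap.fst K X K).comp (.snd K X (X × K))
  let π₃ : X × X × K →L[K] K := (ContinuousLinearMap.snd K X K).comp (.snd K X (X × K))
  have hπ₁ : Set.MapsTo π₁ (slopeDomain K U) U := fun p hp => hp.1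
  induction hf with
  | clm l => exact ⟨_, .clm (l.comp π₂), fun x v t _ => by simp [π₂]⟩
  | @smul c f hf ih =>
    obtain ⟨g, hg, hs⟩ := ih
    refine ⟨_, ((hf.comp π₁ hπ₁).add (hg.smul π₃)).smul (c.comp π₂) |>.add
      (hg.smul (c.comp π₁)), fun x v t hp => ?_⟩
    beta_reduce
    rw [sub_eq_iff_eq_add.mp (hs x v t hp)]
    simp only [map_add, map_smul, smul_eq_mul, ContinuousLinearMap.coe_comp,
      ContinuousLinearMap.coe_fst', ContinuousLinearMap.coe_snd', Function.comp_apply, π₁, π₂, π₃]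
    module
  | add _ _ ih₁ ih₂ =>
    obtain ⟨g₁, hg₁, hs₁⟩ := ih₁
    obtain ⟨g₂, hg₂, hs₂⟩ := ih₂
    exact ⟨_, hg₁.add hg₂, fun x v t hp => by
      rw [smul_add, ← hs₁ x v t hp, ← hs₂ x v t hp, add_sub_add_comm]⟩
  | sub _ _ ih₁ ih₂ =>
    obtain ⟨g₁, hg₁, hs₁⟩ := ih₁
    obtain ⟨g₂, hg₂, hs₂⟩ := ih₂
    exact ⟨_, hg₁.sub hg₂, fun x v t hp => by
      rw [smul_sub, ← hs₁ x v t hp, ← hs₂ x v t hp, sub_sub_sub_comm]⟩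
  | mul hf₁ hf₂ ih₁ ih₂ =>
    obtain ⟨g₁, hg₁, hs₁⟩ := ih₁
    obtain ⟨g₂, hg₂, hs₂⟩ := ih₂
    refine ⟨_, (hg₁.mul ((hf₂.comp π₁ hπ₁).add (hg₂.smul π₃))).add ((hf₁.comp π₁ hπ₁).mul hg₂),
      fun x v t hp => ?_⟩
    beta_reduce
    rw [sub_eq_iff_eq_add.mp (hs₁ x v t hp), sub_eq_iff_eq_add.mp (hs₂ x v t hp)]
    simp only [ContinuousLinearMap.coe_comp, ContinuousLinearMap.coe_fst',
      ContinuousLinearMap.coe_snd', Function.comp_apply, π₁, π₃, add_mul, mul_add, smul_add,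
      smul_mul_assoc, mul_smul_comm]
    abel
  | @inv f hf hU ih =>
    obtain ⟨g, hg, hs⟩ := ih
    have hf₁ := hf.comp π₁ hπ₁
    have hfπ : ∀ p ∈ slopeDomain K U, IsUnit (_root_.jordanQ K (f (π₁ p) + π₃ p • g p)) := by
      rintro ⟨x, v, t⟩ hp
      have h := hU _ hp.2
      rwa [sub_eq_iff_eq_add'.mp (hs x v t hp)] at h
    refine ⟨_, (hf₁.inv fun p hp => hU _ (hπ₁ hp)).jordanQ
      (((hg.jordanQ ((hf₁.add (hg.smul π₃)).inv hfπ)).smul π₃).sub hg), fun x v t hp => ?_⟩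
    have h := hfπ _ hp
    beta_reduce
    rw [sub_eq_iff_eq_add'.mp (hs x v t hp)]
    exact jordanInv_add_smul_sub (hU _ hp.1) h

variable [IsTopologicalRing V] [ContinuousSMul K V] [ContinuousInverseJordan K V]

theorem isCkAux {X : Type (max w v)} [AddCommGroup X] [Module K X] [TopologicalSpace X]
    {U : Set X} {f : X → V} (hf : JordanRational K U f) (k : ℕ) :
    IsCkAux.{w, v, u} K k U f := by
  induction k generalizing X with
  | zero => exact hf.continuousOn
  | succ k ih =>
    obtain ⟨g, hg, hs⟩ := hf.exists_slope
    exact ⟨g, ⟨hg.continuousOn, hs⟩, ih hg⟩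

theorem isSmoothOn {f f' : X → V} {U' : Set X} (hf : JordanRational K U f) (hU : U' ⊆ U)
    (h : Set.EqOn f f' U') : IsSmoothOn K U' f' := fun k =>
  let l : ULift.{v} X →L[K] X := (ContinuousLinearEquiv.ulift : ULift.{v} X ≃L[K] X)
  (isCkAux (hf.comp (U' := ULift.down ⁻¹' U') l fun _ hx => hU hx) k).congr fun _ hx => h hx

end JordanRational

end JordanRational

/-! ### The symmetric space of invertible elements -/

section JordanSymmetricSpace

variable {K : Type v} [CommRing K] {V : Type u} [NonAssocCommRing V] [Module K V]
  [SMulCommClass K V V]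

theorem ContinuousOn.jordanQ [TopologicalSpace V] [IsTopologicalRing V] {X : Type*}
    [TopologicalSpace X] {s : Set X} {f g : X → V}
    (hf : ContinuousOn f s) (hg : ContinuousOn g s) :
    ContinuousOn (fun x => jordanQ K (f x) (g x)) s := by
  simp only [jordanQ_apply, two_smul]
  fun_prop

theorem continuous_jordanL [TopologicalSpace V] [IsTopologicalRing V] (x : V) :
    Continuous (jordanL K x) :=
  continuous_const.mul continuous_id

/-- The product `m(x, y) = Q(x)y⁻¹` on the invertible elements. -/
noncomputable def jordanUnitsMul [Invertible (2 : K)] [IsCommJordan V] (x y : JordanUnits K V) :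
    JordanUnits K V :=
  ⟨jordanQ K (x : V) (jordanInv K (y : V)),
    isUnit_jordanQ_jordanQ x.2 (isUnit_jordanQ_jordanInv y.2)⟩

section Algebra

variable [Invertible (2 : K)] [IsCommJordan V]

theorem coe_jordanUnitsMul (x y : JordanUnits K V) :
    (jordanUnitsMul x y : V) = jordanQ K (x : V) (jordanInv K (y : V)) := rfl

theorem jordanInv_jordanUnitsMul (x y : JordanUnits K V) :
    jordanInv K (jordanUnitsMul x y : V) = Ring.inverse (jordanQ K (x : V)) (y : V) := by
  rw [coe_jordanUnitsMul, jordanInv_jordanQ x.2 (isUnit_jordanQ_jordanInv y.2),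
    jordanInv_jordanInv y.2]

theorem jordanUnitsMul_self (x : JordanUnits K V) : jordanUnitsMul x x = x :=
  Subtype.ext (jordanQ_apply_jordanInv x.2)

theorem jordanUnitsMul_cancel (x y : JordanUnits K V) :
    jordanUnitsMul x (jordanUnitsMul x y) = y := by
  apply Subtype.ext
  rw [coe_jordanUnitsMul, jordanInv_jordanUnitsMul, jordanQ_apply_inverse_jordanQ x.2]

theorem jordanUnitsMul_distrib (x y z : JordanUnits K V) :
    jordanUnitsMul x (jordanUnitsMul y z) =
      jordanUnitsMul (jordanUnitsMul x y) (jordanUnitsMul x z) := by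
  apply Subtype.ext
  rw [coe_jordanUnitsMul, jordanInv_jordanUnitsMul, coe_jordanUnitsMul (jordanUnitsMul x y),
    jordanInv_jordanUnitsMul, coe_jordanUnitsMul x y, jordanQ_jordanQ, jordanQ_jordanInv y.2,
    Module.End.mul_apply, Module.End.mul_apply, jordanQ_apply_inverse_jordanQ x.2]

theorem coe_one_jordanUnitsMul (x : JordanUnits K V) :
    (jordanUnitsMul 1 x : V) = jordanInv K (x : V) := by
  rw [coe_jordanUnitsMul]
  change jordanQ K 1 _ = _
  rw [jordanQ_one, Module.End.one_apply]

end Algebra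

section Charts

variable [TopologicalSpace V] [ContinuousInverseJordan K V]

theorem JordanUnits.chartAt_target (p : JordanUnits K V) :
    (chartAt V p).target = {x : V | IsUnit (jordanQ K x)} := by
  change (Topology.IsOpenEmbedding.toOpenPartialHomeomorph _ _).target = _
  rw [Topology.IsOpenEmbedding.toOpenPartialHomeomorph_target]
  exact Subtype.range_coe

theorem JordanUnits.chartAt_apply (p q : JordanUnits K V) : chartAt V p q = (q : V) := rfl

theorem JordanUnits.coe_chartAt_symm (p : JordanUnits K V) {y : V} (hy : IsUnit (jordanQ K y)) :
    ((chartAt V p).symm y : V) = y :=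
  (chartAt V p).right_inv (by rwa [JordanUnits.chartAt_target])

theorem JordanUnits.eq_chartAt_of_mem_atlas {e : OpenPartialHomeomorph (JordanUnits K V) V}
    (he : e ∈ atlas V (JordanUnits K V)) : e = chartAt V 1 := he

theorem JordanUnits.symm_trans_source (p q : JordanUnits K V) :
    ((chartAt V p).symm.trans (chartAt V q)).source = {x : V | IsUnit (jordanQ K x)} := by
  simp

theorem isOpen_isUnit_jordanQ_prod :
    IsOpen {z : V × V | IsUnit (jordanQ K z.1) ∧ IsUnit (jordanQ K z.2)} :=
  (ContinuousInverseJordan.isOpen_units (K := K) (V := V)).prod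
    (ContinuousInverseJordan.isOpen_units (K := K) (V := V))

variable [Invertible (2 : K)] [IsCommJordan V]

theorem JordanUnits.mulChart_domain (p q r : JordanUnits K V) :
    {z : V × V | z.1 ∈ (chartAt V p).target ∧ z.2 ∈ (chartAt V q).target ∧
      jordanUnitsMul ((chartAt V p).symm z.1) ((chartAt V q).symm z.2) ∈ (chartAt V r).source} =
    {z : V × V | IsUnit (jordanQ K z.1) ∧ IsUnit (jordanQ K z.2)} := by
  simp

theorem JordanUnits.mulChart_eqOn (p q r : JordanUnits K V) :
    Set.EqOn (fun z : V × V => jordanQ K z.1 (jordanInv K z.2))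
      (fun z => chartAt V r
        (jordanUnitsMul ((chartAt V p).symm z.1) ((chartAt V q).symm z.2)))
      {z : V × V | IsUnit (jordanQ K z.1) ∧ IsUnit (jordanQ K z.2)} := by
  intro z hz
  simp only [JordanUnits.chartAt_apply, coe_jordanUnitsMul]
  rw [JordanUnits.coe_chartAt_symm p hz.1, JordanUnits.coe_chartAt_symm q hz.2]

end Charts

section VectorFields

variable [TopologicalSpace K] [HasDenseOpenUnits K] [TopologicalSpace V] [IsTopologicalRing V]
  [T2Space V] [ContinuousSMul K V] [ContinuousInverseJordan K V]

theorem vectorFieldInChart_jordanUnits (p : JordanUnits K V) (X : JordanUnits K V → V) (y : V) :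
    vectorFieldInChart K (chartAt V p) X y = X ((chartAt V p).symm y) := by
  rw [vectorFieldInChart, JordanUnits.symm_trans_source]
  have h : Set.EqOn (ContinuousLinearMap.id K V)
      ((chartAt V ((chartAt V p).symm y)).symm.trans (chartAt V p))
      {x : V | IsUnit (jordanQ K x)} :=
    fun x hx => (JordanUnits.coe_chartAt_symm ((chartAt V p).symm y) hx).symm
  exact ((isSlope_continuousLinearMap _ _).congr h).differential_eq
    (ContinuousInverseJordan.isOpen_units (K := K) (V := V)) ((chartAt V p).symm y).2 _

/-- The bracket of the restrictions of two linear vector fields is the negative of the commutator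
of the linear maps. -/
theorem vectorFieldBracket_linear {X Y : JordanUnits K V → V} (A B : V →L[K] V)
    (hX : ∀ p, X p = A p) (hY : ∀ p, Y p = B p) (p : JordanUnits K V) :
    vectorFieldBracket K X Y p = B (A p) - A (B p) := by
  have hlin : ∀ {Z : JordanUnits K V → V} {C : V →L[K] V}, (∀ q, Z q = C q) →
      Set.EqOn C (vectorFieldInChart K (chartAt V p) Z) {x : V | IsUnit (jordanQ K x)} := by
    intro Z C hZ y hy
    rw [vectorFieldInChart_jordanUnits p Z y, hZ, JordanUnits.coe_chartAt_symm p hy]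
  have hd : ∀ {Z : JordanUnits K V → V} {C : V →L[K] V}, (∀ q, Z q = C q) → ∀ v : V,
      differential K {x : V | IsUnit (jordanQ K x)} (vectorFieldInChart K (chartAt V p) Z) p v =
        C v := fun {Z C} hZ v =>
    ((isSlope_continuousLinearMap _ C).congr (hlin hZ)).differential_eq
      (ContinuousInverseJordan.isOpen_units (K := K) (V := V)) p.2 v
  simp only [vectorFieldBracket, JordanUnits.chartAt_target, JordanUnits.chartAt_apply]
  rw [hd hX, hd hY, ← hlin hX p.2, ← hlin hY p.2]

end VectorFields

section Calculus

variable [TopologicalSpace K] [Invertible (2 : K)] [IsCommJordan V] [IsScalarTower K V V]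
  [TopologicalSpace V] [IsTopologicalRing V] [ContinuousSMul K V] [ContinuousInverseJordan K V]

theorem isSmoothManifold_jordanUnits : IsSmoothManifold K V (JordanUnits K V) where
  compatible e he e' he' := by
    rw [JordanUnits.eq_chartAt_of_mem_atlas he, JordanUnits.eq_chartAt_of_mem_atlas he']
    refine (JordanRational.clm (U := Set.univ) (.id K V)).isSmoothOn (Set.subset_univ _) ?_
    rw [JordanUnits.symm_trans_source]
    exact fun x hx => (JordanUnits.coe_chartAt_symm 1 hx).symm

theorem isSmoothMul_jordanUnitsMul :
    IsSmoothMul K V (jordanUnitsMul : JordanUnits K V → JordanUnits K V → JordanUnits K V) := by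
  constructor
  · refine Continuous.subtype_mk ?_ _
    have h₂ : Continuous fun p : JordanUnits K V × JordanUnits K V => jordanInv K (p.2 : V) :=
      (ContinuousInverseJordan.continuousOn_inv (K := K) (V := V)).comp_continuous
        (by fun_prop) fun p => p.2.2
    have h₁ : Continuous fun p : JordanUnits K V × JordanUnits K V => (p.1 : V) := by fun_prop
    rw [← continuousOn_univ] at h₁ h₂ ⊢
    exact h₁.jordanQ h₂
  · intro e₁ he₁ e₂ he₂ e he
    rw [JordanUnits.eq_chartAt_of_mem_atlas he₁, JordanUnits.eq_chartAt_of_mem_atlas he₂,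
      JordanUnits.eq_chartAt_of_mem_atlas he, JordanUnits.mulChart_domain]
    exact ((JordanRational.clm (.fst K V V)).jordanQ
      ((JordanRational.clm (.snd K V V)).inv fun z hz => hz.2)).isSmoothOn subset_rfl
        (JordanUnits.mulChart_eqOn 1 1 1)

/-- The difference quotient of `(x, y) ↦ Q(x)y⁻¹`. -/
theorem isSlope_jordanQ_jordanInv :
    IsSlope K {z : V × V | IsUnit (jordanQ K z.1) ∧ IsUnit (jordanQ K z.2)}
      (fun z => jordanQ K z.1 (jordanInv K z.2))
      (fun p => (2 : K) • jordanP K p.1.1 p.2.1.1 (jordanInv K (p.1.2 + p.2.2 • p.2.1.2)) +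
        p.2.2 • jordanQ K p.2.1.1 (jordanInv K (p.1.2 + p.2.2 • p.2.1.2)) +
        jordanQ K p.1.1 (jordanQ K (jordanInv K p.1.2)
          (p.2.2 • jordanQ K p.2.1.2 (jordanInv K (p.1.2 + p.2.2 • p.2.1.2)) - p.2.1.2))) := by
  constructor
  · set s := slopeDomain K {z : V × V | IsUnit (jordanQ K z.1) ∧ IsUnit (jordanQ K z.2)}
    have h₁ : ContinuousOn (fun p : (V × V) × (V × V) × K => jordanInv K p.1.2) s :=
      ContinuousInverseJordan.continuousOn_inv.comp (by fun_prop) fun p hp => hp.1.2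
    have h₂ : ContinuousOn
        (fun p : (V × V) × (V × V) × K => jordanInv K (p.1.2 + p.2.2 • p.2.1.2)) s :=
      ContinuousInverseJordan.continuousOn_inv.comp (by fun_prop) fun p hp => hp.2.2
    have hx : ContinuousOn (fun p : (V × V) × (V × V) × K => p.1.1) s := by fun_prop
    have hv : ContinuousOn (fun p : (V × V) × (V × V) × K => p.2.1.1) s := by fun_prop
    have hw : ContinuousOn (fun p : (V × V) × (V × V) × K => p.2.1.2) s := by fun_prop
    have ht : ContinuousOn (fun p : (V × V) × (V × V) × K => p.2.2) s := by fun_prop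
    refine (ContinuousOn.add (ContinuousOn.const_smul ?_ 2) (ht.smul (hv.jordanQ h₂))).add
      (hx.jordanQ (h₁.jordanQ ((ht.smul (hw.jordanQ h₂)).sub hw)))
    simp only [jordanP_apply]
    exact ((hx.mul (hv.mul h₂)).add (hv.mul (hx.mul h₂))).sub ((hx.mul hv).mul h₂)
  · rintro ⟨x, y⟩ ⟨v, w⟩ t ⟨hp, hp'⟩
    have h := jordanInv_add_smul_sub (K := K) hp.2 hp'.2
    simp only [Prod.smul_mk, Prod.mk_add_mk] at h ⊢
    rw [jordanQ_add_smul_apply]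
    generalize jordanInv K (y + t • w) = y' at h ⊢
    rw [smul_add _ (_ + _), ← map_smul (jordanQ K x), ← h, map_sub]
    abel

variable [HasDenseOpenUnits K] [T2Space V]

theorem tangentMulAt_jordanUnitsMul (x y : JordanUnits K V) (δ ε : V) :
    tangentMulAt K jordanUnitsMul x y δ ε =
      (2 : K) • jordanP K (x : V) δ (jordanInv K (y : V)) -
        jordanQ K (x : V) (jordanQ K (jordanInv K (y : V)) ε) := by
  have h := (isSlope_jordanQ_jordanInv.congr
    (JordanUnits.mulChart_eqOn x y (jordanUnitsMul x y))).differential_eq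
      isOpen_isUnit_jordanQ_prod (x := ((x : V), (y : V))) ⟨x.2, y.2⟩ (δ, ε)
  rw [tangentMulAt, JordanUnits.mulChart_domain]
  refine h.trans ?_
  simp [sub_eq_add_neg]

theorem tangentMapAt_jordanUnitsMul (x : JordanUnits K V) (δ : V) :
    tangentMapAt K (jordanUnitsMul x) x δ = -δ := by
  have hdom : {y : V | y ∈ (chartAt V x).target ∧ jordanUnitsMul x ((chartAt V x).symm y) ∈
      (chartAt V (jordanUnitsMul x x)).source} = {y : V | IsUnit (jordanQ K y)} := by
    simp
  have heq : Set.EqOn (fun y : V => jordanQ K (x : V) (jordanInv K y))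
      (fun y => chartAt V (jordanUnitsMul x x) (jordanUnitsMul x ((chartAt V x).symm y)))
      {y : V | IsUnit (jordanQ K y)} := by
    intro y hy
    simp only [JordanUnits.chartAt_apply, coe_jordanUnitsMul]
    rw [JordanUnits.coe_chartAt_symm x hy]
  have hslope := (isSlope_jordanQ_jordanInv.comp_mk_left (K := K) (x : V)
    (U' := {y : V | IsUnit (jordanQ K y)}) fun y hy => ⟨x.2, hy⟩).congr heq
  rw [tangentMapAt, hdom]
  refine (hslope.differential_eq
    (ContinuousInverseJordan.isOpen_units (K := K) (V := V)) x.2 δ).trans ?_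
  simp [jordanP_apply, jordanQ_jordanInv x.2, jordanQ_apply_inverse_jordanQ x.2]

/-- The odd derivation with value `δ` at `1` is the linear vector field `L(δ)`: the derivative of
`x ↦ Q(x)p` at `1` is `2 L(δ)p`. -/
theorem oddDerivation_jordanUnitsMul (δ : V) (p : JordanUnits K V) :
    oddDerivation K jordanUnitsMul 1 δ p = jordanL K δ (p : V) := by
  have h₁ : ((1 : JordanUnits K V) : V) = 1 := rfl
  rw [oddDerivation, tangentMulAt_jordanUnitsMul, tangentMulAt_jordanUnitsMul, h₁,
    jordanP_one_apply, jordanP_one_apply, coe_one_jordanUnitsMul, jordanInv_jordanInv p.2,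
    jordanL_apply]
  simp

theorem tripleBracket_jordanUnitsMul (x y z : V) :
    tripleBracket K jordanUnitsMul (1 : JordanUnits K V) x y z = x * (y * z) - y * (x * z) := by
  let l (a : V) : V →L[K] V := ⟨jordanL K a, continuous_jordanL a⟩
  have h := vectorFieldBracket_linear (l y * l x - l x * l y) (l z)
    (X := vectorFieldBracket K (oddDerivation K jordanUnitsMul 1 x)
      (oddDerivation K jordanUnitsMul 1 y))
    (fun p => vectorFieldBracket_linear (l x) (l y) (oddDerivation_jordanUnitsMul x)
      (oddDerivation_jordanUnitsMul y) p) (oddDerivation_jordanUnitsMul z) 1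
  rw [tripleBracket, h]
  change z * (y * (x * 1) - x * (y * 1)) - (y * (x * (z * 1)) - x * (y * (z * 1))) = _
  simp only [mul_one, mul_comm y x, sub_self, mul_zero]
  abel

theorem isSymmetricSpace_jordanUnits :
    IsSymmetricSpace K V
      (jordanUnitsMul : JordanUnits K V → JordanUnits K V → JordanUnits K V) where
  isSmoothManifold := isSmoothManifold_jordanUnits
  isSmoothMul := isSmoothMul_jordanUnitsMul
  mul_self := jordanUnitsMul_self
  mul_mul_cancel := jordanUnitsMul_cancel
  mul_mul_distrib := jordanUnitsMul_distrib
  tangentMap_symmetry := tangentMapAt_jordanUnitsMul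

end Calculus

end JordanSymmetricSpace

theorem theorem3p4 {K : Type v} [CommRing K] [TopologicalSpace K] [IsTopologicalRing K]
    [HasDenseOpenUnits K] [Invertible (2 : K)]
    {V : Type u} [NonAssocCommRing V] [IsCommJordan V]
    [Module K V] [IsScalarTower K V V] [SMulCommClass K V V]
    [TopologicalSpace V] [IsTopologicalRing V] [ContinuousSMul K V] [T2Space V]
    [ContinuousInverseJordan K V] :
    ∃ m : JordanUnits K V → JordanUnits K V → JordanUnits K V,
      (∀ x y : JordanUnits K V,
        (m x y : V) = jordanQ K (x : V) (jordanInv K (y : V)) ∧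
        (m x y : V) = jordanQ K (x : V) (Ring.inverse (jordanQ K (y : V)) (y : V))) ∧
      ∃ h : IsSymmetricSpace K V m,
        (∃ q : QuadraticMap K V (Module.End K V),
          (∀ x : V, q x = jordanQ K x) ∧
          Continuous (fun p : V × V => q p.1 p.2) ∧
          ∀ x y : JordanUnits K V,
            (((h.quadraticRep 1 x : Equiv.Perm (JordanUnits K V)) y : JordanUnits K V) : V) =
              q (x : V) (y : V)) ∧
        ∀ x y z : V,
          -curvature K m 1 x y z = ⁅⁅jordanL K x, jordanL K y⁆, jordanL K z⁆ (1 : V) ∧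
          -curvature K m 1 x y z = ⁅jordanL K x, jordanL K y⁆ z ∧
          -curvature K m 1 x y z = x * (y * z) - y * (x * z) := by
  refine ⟨jordanUnitsMul, fun x y => ⟨rfl, rfl⟩, isSymmetricSpace_jordanUnits,
    ⟨jordanQuadraticMap K V, fun x => rfl, ?_, fun x y => ?_⟩, fun x y z => ?_⟩
  · rw [← continuousOn_univ]
    exact continuousOn_fst.jordanQ continuousOn_snd
  · change jordanQ K (x : V) (jordanInv K (jordanUnitsMul 1 y : V)) = jordanQ K (x : V) (y : V)
    rw [coe_one_jordanUnitsMul, jordanInv_jordanInv y.2]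
  · rw [curvature, neg_neg, tripleBracket_jordanUnitsMul]
    refine ⟨?_, ?_, rfl⟩
    · simp only [Ring.lie_def, LinearMap.sub_apply, Module.End.mul_apply, jordanL_apply, mul_one,
        mul_comm y x, sub_self, mul_zero, sub_zero]
    · simp only [Ring.lie_def, LinearMap.sub_apply, Module.End.mul_apply, jordanL_apply]
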